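/- Let $\chi_1,\chi_{2a},\chi_{2b},\chi_{-4}$ be the 4-periodic functions on the positive integers whose values at $1,2,3,4$ are, respectively, $(1,1,1,1)$, $(1,0,1,0)$, $(1,-1,1,-1)$, $(1,0,-1,0)$. For $p,q\in\{1,2a,2b,-4\}$ and positive integers $s,t$ put $$[p,q](s,t)=\sum_{n=1}^\infty\sum_{m=1}^{n-1}\frac{\chi_p(n)}{n^s}\frac{\chi_q(m)}{m^t},$$ the outer series being the limit of its partial sums whenever it converges. Let $\zeta$ be the Riemann zeta function and $\beta(s)=\sum_{n\ge1}\chi_{-4}(n)n^{-s}$ the Dirichlet beta function. **Theorem.** Let $n\ge2$ be an integer. The series $[p,q](2k,2n-2k)$ (all $p,q$; $1\le k\le n-1$), $[-4,-4](2k+1,2n-1-2k)$ ($0\le k\le n-1$), $[p,-4](2k,2n+1-2k)$ and $[-4,p](2n+1-2k,2k)$ (all $p$; $1\le k\le n$) converge, the series for $\beta(2n+1)$ converges absolutely, and the following hold. 1. $$2\sum_{k=1}^{n-1}\bigl([1,2b](2k,2n-2k)+[2b,1](2k,2n-2k)\bigr)=-4\sum_{k=1}^{n-1}[2b,2b](2k,2n-2k)=(1-4^{1-n})\zeta(2n).$$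 2. $$4\sum_{k=1}^{n-1}[2a,2a](2k,2n-2k)=-4\sum_{k=0}^{n-1}[-4,-4](2k+1,2n-1-2k)$$ $$=\sum_{k=1}^{n-1}\bigl([1,2a](2k,2n-2k)+[2a,1](2k,2n-2k)\bigr)=(1-4^{-n})\zeta(2n).$$ 3. $$\sum_{k=1}^{n}\bigl([2a,-4](2k,2n+1-2k)+[-4,2a](2n+1-2k,2k)\bigr)=\sum_{k=1}^{n-1}\bigl([2a,2b](2k,2n-2k)+[2b,2a](2n-2k,2k)\bigr)=0.$$ 4. $$2\sum_{k=1}^{n}\bigl([1,-4](2k,2n+1-2k)+[-4,1](2n+1-2k,2k)\bigr)=-2\sum_{k=1}^{n}\bigl([2b,-4](2k,2n+1-2k)+[-4,2b](2n+1-2k,2k)\bigr)$$ $$=\beta(2n+1)+(16^{-n}-2^{-1-2n})\,\pi\,\zeta(2n).$$ -/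

import Mathlib

/-- The labels `1`, `2a`, `2b`, `-4` of the four 4-periodic functions. -/
inductive CharLabel where
  | one
  | twoA
  | twoB
  | negFour

/-- The 4-periodic function `χ_p`. On `n = 1, 2, 3, 4` its values are
`1, 1, 1, 1` for `p = 1`; `1, 0, 1, 0` for `p = 2a`; `1, -1, 1, -1` for `p = 2b`;
`1, 0, -1, 0` for `p = -4`. -/
def chi : CharLabel → ℕ → ℤ
  | .one, _ => 1
  | .twoA, n => if n % 2 = 1 then 1 else 0
  | .twoB, n => if n % 2 = 1 then 1 else -1
  | .negFour, n => if n % 4 = 1 then 1 else if n % 4 = 3 then -1 else 0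

/-- The `n`-th term (`n ≥ 1`) of the series for `L_p(s)`. -/
noncomputable def charLTerm (p : CharLabel) (s n : ℕ) : ℂ :=
  (chi p n : ℂ) / (n : ℂ) ^ s

/-- `L_p(s) = ∑_{n ≥ 1} χ_p(n) / n ^ s`, the limit of the partial sums over `1 ≤ n ≤ N`. -/
noncomputable def charL (p : CharLabel) (s : ℕ) : ℂ :=
  ∑'[SummationFilter.conditional ℕ] n : ℕ, charLTerm p s (n + 1)

/-- The Dirichlet beta function `β = L_{-4}` at a natural number. -/
noncomputable def dirichletBeta (s : ℕ) : ℂ := charL .negFour s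

/-- The `n`-th term (`n ≥ 1`) of the outer series of `[p,q](s,t)`:
`∑_{m=1}^{n-1} (χ_p(n) / n ^ s) (χ_q(m) / m ^ t)`. -/
noncomputable def charSumTerm (p q : CharLabel) (s t n : ℕ) : ℂ :=
  ∑ m ∈ Finset.Ico 1 n, ((chi p n : ℂ) / (n : ℂ) ^ s) * ((chi q m : ℂ) / (m : ℂ) ^ t)

/-- Convergence of the outer series of `[p,q](s,t)`, as a limit of partial sums over
`1 ≤ n ≤ N` (the convergence need not be absolute). -/
def CharSumConverges (p q : CharLabel) (s t : ℕ) : Prop :=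
  Summable (fun n : ℕ => charSumTerm p q s t (n + 1)) (SummationFilter.conditional ℕ)

/-- The character sum `[p,q](s,t) = ∑_{n ≥ 1} ∑_{m=1}^{n-1} (χ_p(n) / n ^ s) (χ_q(m) / m ^ t)`,
the limit of the partial sums over `1 ≤ n ≤ N`. -/
noncomputable def charSum (p q : CharLabel) (s t : ℕ) : ℂ :=
  ∑'[SummationFilter.conditional ℕ] n : ℕ, charSumTerm p q s t (n + 1)

open Filter Topology Finset

/-! Adding `[p,q](s,t)` and `[q,p](t,s)`, both cut at `N`, gives the sum of `χ_p(a) χ_q(b) / (a^s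
b^t)` over the square `1 ≤ a, b ≤ N` without its diagonal. Summed over `k`, the monomials form a
geometric progression in `a⁻²` and `b⁻²`, so the kernel splits into a power of `b` times `1/(a² -
b²)` or `a/(a² - b²)`, plus the mirror term (`sum_inv_pow_mul_inv_pow`, `sum_charSum_eq`).

The inner sum over `a ≠ b` comes from the symmetric sum of `χ(a)/(a - b)` over `ℤ`. Moving the pole
to `0` costs only vanishing boundary terms, and there the sum is zero by oddness or is a multiple of
the Leibniz series. The unpaired terms at `a = 0` and `a = -b` supply the closed forms
(`tendsto_sum_chi_div_sq_sub`, `tendsto_sum_chi_negFour_mul_div_sq_sub`).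

Bounds on the truncated inner sums, uniform in `N`, let the limit pass through the outer sum. What
remains is a single series in `b`, a combination of `ζ(2n)`, `β(2n+1)` and `π ζ(2n)`. -/

/-- Tannery's theorem for partial sums whose summands depend on the length. -/
theorem tendsto_sum_range_of_dominated {w : ℕ → ℝ} {Φ : ℕ → ℕ → ℝ} {L B : ℕ → ℝ}
    (hB : Summable B) (hb : ∀ N j, |w j * Φ N j| ≤ B j)
    (hL : ∀ j, Tendsto (fun N => Φ N j) atTop (𝓝 (L j))) :
    Tendsto (fun N => ∑ j ∈ range N, w j * Φ N j) atTop (𝓝 (∑' j, w j * L j)) := by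
  have hpt : ∀ j, Tendsto (fun N => if j < N then w j * Φ N j else 0) atTop (𝓝 (w j * L j)) := by
    intro j
    refine ((hL j).const_mul (w j)).congr' ?_
    filter_upwards [eventually_gt_atTop j] with N hN
    simp [hN]
  have := tendsto_tsum_of_dominated_convergence (𝓕 := atTop)
    (f := fun N j => if j < N then w j * Φ N j else 0) hB hpt (Eventually.of_forall fun N j => by
      by_cases h : j < N
      · simpa [h] using hb N j
      · simpa [h] using (abs_nonneg _).trans (hb N j))
  refine this.congr fun N => ?_
  rw [tsum_eq_sum (s := range N) (fun j hj => by simp_all)]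
  exact sum_congr rfl fun j hj => by simp_all

/-! ### Symmetric sums over the integers under translation -/

/-- The sum of `h` over the integers in `[-N, N]`. -/
def symmSum (h : ℤ → ℝ) (N : ℕ) : ℝ := h 0 + ∑ i ∈ range N, (h (i + 1) + h (-(i + 1)))

theorem symmSum_shift (h : ℤ → ℝ) (N : ℕ) :
    symmSum (fun c => h (c - 1)) N - symmSum h N = h (-N - 1) - h N := by
  induction N with
  | zero => simp [symmSum]
  | succ N ih =>
    simp only [symmSum, sum_range_succ] at ih ⊢
    push_cast
    have e : (-(N : ℤ) - 1) = -(N + 1) := by ring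
    rw [e, zero_sub] at ih
    have e1 : (N : ℤ) + 1 - 1 = N := by ring
    rw [e1]
    linarith

/-- Each unit shift telescopes to two boundary values of `h`, which tend to zero. No summability of
`h` is needed. -/
theorem tendsto_symmSum_shift {h : ℤ → ℝ} (h₁ : Tendsto h atTop (𝓝 0))
    (h₂ : Tendsto h atBot (𝓝 0)) (b : ℕ) :
    Tendsto (fun N => symmSum (fun c => h (c - b)) N - symmSum h N) atTop (𝓝 0) := by
  induction b with
  | zero => simp
  | succ b ih =>
    have key : Tendsto (fun N : ℕ => h (-N - 1 - b) - h (N - b)) atTop (𝓝 (0 - 0)) := by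
      refine Tendsto.sub (h₂.comp ?_) (h₁.comp ?_)
      · refine tendsto_atBot.2 fun m => ?_
        filter_upwards [eventually_ge_atTop (-m).toNat] with N hN
        omega
      · refine tendsto_atTop.2 fun m => ?_
        filter_upwards [eventually_ge_atTop (m + b).toNat] with N hN
        omega
    have := key.add ih
    simp only [sub_zero, add_zero] at this
    refine this.congr fun N => ?_
    rw [← symmSum_shift (fun c => h (c - b)) N]
    have e : (fun c : ℤ => h (c - 1 - b)) = fun c => h (c - ((b + 1 : ℕ) : ℤ)) := by
      funext c; congr 1; push_cast; ring
    rw [e]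
    ring

/-! ### Symmetries of the 4-periodic functions -/

/-- The 4-periodic extension of `chi p` to the integers. -/
noncomputable def chiInt (p : CharLabel) (a : ℤ) : ℝ := (chi p (a : ZMod 4).val : ℝ)

theorem chi_mod_four (p : CharLabel) (n : ℕ) : chi p (n % 4) = chi p n := by
  cases p <;> simp [chi]

theorem chiInt_natCast (p : CharLabel) (n : ℕ) : chiInt p n = chi p n := by
  simp only [chiInt, Int.cast_natCast, ZMod.val_natCast, chi_mod_four]

theorem abs_chi_le_one (p : CharLabel) (n : ℕ) : |(chi p n : ℝ)| ≤ 1 := by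
  cases p <;> simp only [chi] <;> (try split_ifs) <;> simp

theorem abs_chiInt_le_one (p : CharLabel) (a : ℤ) : |chiInt p a| ≤ 1 := abs_chi_le_one p _

/-- Apart from `χ_{-4}`, the functions depend only on parity, and `-c + b` and `c + b` differ by
`2c`. -/
theorem chiInt_neg_add {p : CharLabel} (hp : p ≠ .negFour) (b c : ℤ) :
    chiInt p (-c + b) = chiInt p (c + b) := by
  have : ∀ x y : ZMod 4, chi p (-x + y).val = chi p (x + y).val := by
    cases p <;> first | exact absurd rfl hp | decide
  simp only [chiInt]
  push_cast
  rw [this]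

theorem chiInt_negFour_neg (a : ℤ) : chiInt .negFour (-a) = -chiInt .negFour a := by
  have : ∀ x : ZMod 4, chi .negFour (-x).val = -chi .negFour x.val := by decide
  simp only [chiInt]
  push_cast
  rw [this]
  simp

/-- With `χ_{-4}(a) = sin(πa/2)`, this is the reflection symmetry of the sine about its extrema. -/
theorem chiInt_negFour_neg_add {b : ℕ} (hb : b % 2 = 1) (c : ℤ) :
    chiInt .negFour (-c + b) = chiInt .negFour (c + b) := by
  have : ∀ x y : ZMod 4, y.val % 2 = 1 →
      chi .negFour (-x + y).val = chi .negFour (x + y).val := by decide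
  simp only [chiInt]
  push_cast
  rw [this _ _ (by rw [ZMod.val_natCast]; omega)]

/-- `(-1) ^ (n / 2)` for even `n`, and `0` for odd `n`. -/
def evenSign (n : ℕ) : ℤ := if n % 4 = 0 then 1 else if n % 4 = 2 then -1 else 0

/-- The addition formula for `sin(π(c + b)/2)`, where `evenSign b = cos(πb/2)` and `sin(πb/2) = 0`.
-/
theorem chiInt_negFour_add {b : ℕ} (hb : b % 2 = 0) (c : ℤ) :
    chiInt .negFour (c + b) = evenSign b * chiInt .negFour c := by
  have : ∀ x y : ZMod 4, y.val % 2 = 0 →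
      chi .negFour (x + y).val = evenSign y.val * chi .negFour x.val := by decide
  have e : evenSign (b % 4) = evenSign b := by simp [evenSign]
  simp only [chiInt]
  push_cast
  rw [this _ _ (by rw [ZMod.val_natCast]; omega), ZMod.val_natCast, e]
  push_cast
  rfl

theorem tendsto_chiInt_mul_inv (p : CharLabel) (b : ℤ) {l : Filter ℤ}
    (hl : Tendsto (fun c : ℤ => (c : ℝ)⁻¹) l (𝓝 0)) :
    Tendsto (fun c : ℤ => chiInt p (c + b) * (c : ℝ)⁻¹) l (𝓝 0) := by
  refine squeeze_zero_norm (a := fun c : ℤ => ‖(c : ℝ)⁻¹‖) (fun c => ?_) (by simpa using hl.norm)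
  rw [norm_mul]
  exact mul_le_of_le_one_left (norm_nonneg _) (abs_chiInt_le_one p _)

/-! ### Closed forms of the inner sums -/

/-- Moving the pole of a symmetric sum of `chiInt p a / (a - b)` to the origin. -/
theorem tendsto_symmSum_chiInt (p : CharLabel) (b : ℕ) :
    Tendsto (fun N => symmSum (fun a => chiInt p a * ((a : ℝ) - b)⁻¹) N
      - symmSum (fun c => chiInt p (c + b) * (c : ℝ)⁻¹) N) atTop (𝓝 0) := by
  have h := tendsto_symmSum_shift
    (tendsto_chiInt_mul_inv p b (tendsto_inv_atTop_zero.comp tendsto_intCast_atTop_atTop))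
    (tendsto_chiInt_mul_inv p b (tendsto_inv_atBot_zero.comp (tendsto_intCast_atBot_iff.2 tendsto_id))) b
  refine h.congr fun N => ?_
  congr 2
  funext a
  simp

theorem symmSum_eq_zero {h : ℤ → ℝ} (hh : ∀ c, h (-c) = -h c) (N : ℕ) : symmSum h N = 0 := by
  have h0 : h 0 = 0 := by have := hh 0; simp only [neg_zero] at this; linarith
  simp only [symmSum, hh, h0, add_neg_cancel, sum_const_zero, add_zero]

theorem sum_range_ite_succ {N b : ℕ} (hb : 0 < b) (hN : b ≤ N) (f : ℕ → ℝ) :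
    ∑ i ∈ range N, (if i + 1 = b then f (i + 1) else 0) = f b := by
  rw [sum_eq_single (b - 1)]
  · rw [Nat.sub_add_cancel hb, if_pos rfl]
  · intro i _ hi
    rw [if_neg (by omega)]
  · intro h
    exact absurd (mem_range.2 (by omega)) h

/-- Pairing `a` with `-a` turns `χ(a)/(a - b)` into `2b χ(a)/(a² - b²)`. The term `a = 0` gives
`-χ(0)/b`, and `a = -b`, whose partner is the removed pole, gives `-χ(b)/(2b)`; the total tends to
zero. -/
theorem tendsto_sum_chi_div_sq_sub {p : CharLabel} (hp : p ≠ .negFour) {b : ℕ} (hb : 0 < b) :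
    Tendsto (fun N => ∑ i ∈ range N, (chi p (i + 1) : ℝ) * (((i + 1 : ℕ) : ℝ) ^ 2 - (b : ℝ) ^ 2)⁻¹)
      atTop (𝓝 ((2 * chi p 0 + chi p b) / (4 * (b : ℝ) ^ 2))) := by
  have hb' : (b : ℝ) ≠ 0 := by positivity
  have h := tendsto_symmSum_chiInt p b
  have h0 : ∀ N, symmSum (fun c => chiInt p (c + b) * (c : ℝ)⁻¹) N = 0 := by
    refine symmSum_eq_zero fun c => ?_
    rw [chiInt_neg_add hp]
    push_cast
    rw [inv_neg]
    ring
  simp only [h0, sub_zero] at h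
  have h' := ((h.add_const ((chi p 0 : ℝ) / b)).const_mul (1 / (2 * (b : ℝ)))).add_const
    ((chi p b : ℝ) / (4 * (b : ℝ) ^ 2))
  have e : 1 / (2 * (b : ℝ)) * (0 + (chi p 0 : ℝ) / b) + (chi p b : ℝ) / (4 * (b : ℝ) ^ 2)
      = (2 * chi p 0 + chi p b) / (4 * (b : ℝ) ^ 2) := by
    field_simp
    ring
  rw [e] at h'
  refine h'.congr' ?_
  filter_upwards [eventually_ge_atTop b] with N hN
  -- The correction is placed at the single index `a = b`, so that the two sums can be compared term
  -- by term.
  rw [← sum_range_ite_succ hb hN (fun n => (chi p n : ℝ) / (4 * (b : ℝ) ^ 2))]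
  have hz : chiInt p 0 = chi p 0 := by simpa using chiInt_natCast p 0
  simp only [symmSum, hz]
  have : ((0 : ℤ) : ℝ) - b = -b := by simp
  rw [this, inv_neg]
  have : (chi p 0 : ℝ) * -(b : ℝ)⁻¹ + ∑ i ∈ range N,
        (chiInt p (i + 1) * ((((i : ℤ) + 1 : ℤ) : ℝ) - b)⁻¹
          + chiInt p (-(i + 1)) * (((-((i : ℤ) + 1) : ℤ) : ℝ) - b)⁻¹) + (chi p 0 : ℝ) / b
      = ∑ i ∈ range N, (chiInt p (i + 1) * ((((i : ℤ) + 1 : ℤ) : ℝ) - b)⁻¹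
          + chiInt p (-(i + 1)) * (((-((i : ℤ) + 1) : ℤ) : ℝ) - b)⁻¹) := by
    ring
  rw [this, mul_sum, ← sum_add_distrib]
  refine sum_congr rfl fun i _ => ?_
  have e1 : chiInt p (-((i : ℤ) + 1)) = chi p (i + 1) := by
    have := chiInt_neg_add hp 0 (i + 1)
    rw [add_zero, add_zero] at this
    rw [this, ← chiInt_natCast]
    push_cast
    rfl
  have e2 : chiInt p ((i : ℤ) + 1) = chi p (i + 1) := by
    rw [← chiInt_natCast]
    push_cast
    rfl
  rw [e1, e2]
  push_cast
  have hs : (i : ℝ) + 1 + b ≠ 0 := by positivity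
  have hs' : -((i : ℝ) + 1) - b ≠ 0 := by
    rw [show -((i : ℝ) + 1) - b = -((i : ℝ) + 1 + b) by ring]
    exact neg_ne_zero.2 hs
  split_ifs with hib
  -- On the diagonal `0⁻¹ = 0` deletes the pole, and the correction cancels the surviving term from
  -- `a = -b`.
  · have : (b : ℝ) = i + 1 := by rw [← hib]; push_cast; ring
    rw [this] at hb' ⊢
    simp only [sub_self, inv_zero]
    rw [show -((i : ℝ) + 1) - (i + 1) = -(2 * (i + 1)) by ring]
    field_simp
    ring
  · have hd : (i : ℝ) + 1 - b ≠ 0 := by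
      intro h
      apply hib
      have : (i : ℝ) + 1 = b := by linarith
      exact_mod_cast this
    rw [show ((i : ℝ) + 1) ^ 2 - (b : ℝ) ^ 2 = (i + 1 - b) * (i + 1 + b) by ring,
      show -((i : ℝ) + 1) - b = -((i : ℝ) + 1 + b) by ring]
    field_simp
    ring

/-- The Leibniz series, with its vanishing terms kept. -/
theorem tendsto_sum_chi_negFour_div :
    Tendsto (fun N => ∑ i ∈ range N, (chi .negFour (i + 1) : ℝ) * ((i + 1 : ℕ) : ℝ)⁻¹)
      atTop (𝓝 (Real.pi / 4)) := by
  have h : ∀ N, ∑ i ∈ range N, (chi .negFour (i + 1) : ℝ) * ((i + 1 : ℕ) : ℝ)⁻¹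
      = ∑ i ∈ range ((N + 1) / 2), (-1 : ℝ) ^ i / (2 * i + 1) := by
    intro N
    induction N with
    | zero => simp
    | succ N ih =>
      rw [sum_range_succ, ih]
      obtain ⟨m, hm | hm⟩ := N.even_or_odd'
      · rw [show (N + 1) / 2 = m by omega, show (N + 1 + 1) / 2 = m + 1 by omega, sum_range_succ]
        congr 1
        obtain ⟨l, hl | hl⟩ := m.even_or_odd'
        · have : chi .negFour (N + 1) = 1 := by simp only [chi]; rw [if_pos (by omega)]
          rw [this, hl, hm, hl, pow_mul]
          push_cast
          simp
        · have : chi .negFour (N + 1) = -1 := by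
            simp only [chi]; rw [if_neg (by omega), if_pos (by omega)]
          rw [this, hl, hm, hl, pow_succ, pow_mul]
          push_cast
          simp [div_eq_mul_inv]
      · have : chi .negFour (N + 1) = 0 := by
          simp only [chi]; rw [if_neg (by omega), if_neg (by omega)]
        rw [show (N + 1) / 2 = m + 1 by omega, show (N + 1 + 1) / 2 = m + 1 by omega, this]
        simp
  simp only [h]
  refine Real.tendsto_sum_pi_div_four.comp (tendsto_atTop.2 fun m => ?_)
  filter_upwards [eventually_ge_atTop (2 * m)] with N hN
  omega

/-- Since `χ_{-4}` is odd, pairing `±a` now gives `2a χ(a)/(a² - b²)`. After the pole is moved, odd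
`b` leaves an odd summand with sum zero, while even `b` leaves `2 · evenSign b` times the Leibniz
series. -/
theorem tendsto_sum_chi_negFour_mul_div_sq_sub {b : ℕ} (hb : 0 < b) :
    Tendsto (fun N => ∑ i ∈ range N, (chi .negFour (i + 1) : ℝ) *
        (((i + 1 : ℕ) : ℝ) * (((i + 1 : ℕ) : ℝ) ^ 2 - (b : ℝ) ^ 2)⁻¹))
      atTop (𝓝 (Real.pi / 4 * evenSign b - chi .negFour b / (4 * (b : ℝ)))) := by
  have hb' : (b : ℝ) ≠ 0 := by positivity
  have e2 (i : ℕ) : chiInt .negFour ((i : ℤ) + 1) = chi .negFour (i + 1) := by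
    rw [← chiInt_natCast]
    push_cast
    rfl
  have e1 (i : ℕ) : chiInt .negFour (-((i : ℤ) + 1)) = -chi .negFour (i + 1) := by
    rw [chiInt_negFour_neg, e2]
  have hz : chiInt .negFour 0 = 0 := by simp [chiInt, chi]
  have h := tendsto_symmSum_chiInt .negFour b
  have h0 : Tendsto (fun N => symmSum (fun c => chiInt .negFour (c + b) * (c : ℝ)⁻¹) N) atTop
      (𝓝 (Real.pi / 2 * evenSign b)) := by
    rcases Nat.mod_two_eq_zero_or_one b with hb2 | hb2
    · have := tendsto_sum_chi_negFour_div.const_mul (2 * (evenSign b : ℝ))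
      rw [show 2 * (evenSign b : ℝ) * (Real.pi / 4) = Real.pi / 2 * evenSign b by ring] at this
      refine this.congr fun N => ?_
      simp only [symmSum, chiInt_negFour_add hb2, e1, e2, Int.cast_zero, inv_zero, mul_zero,
        zero_add, mul_sum]
      refine sum_congr rfl fun i _ => ?_
      push_cast
      rw [inv_neg]
      ring
    · have he : evenSign b = 0 := by
        simp only [evenSign]
        rw [if_neg (by omega), if_neg (by omega)]
      have : ∀ N, symmSum (fun c => chiInt .negFour (c + b) * (c : ℝ)⁻¹) N = 0 := by
        refine symmSum_eq_zero fun c => ?_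
        rw [chiInt_negFour_neg_add hb2]
        push_cast
        rw [inv_neg]
        ring
      simp [this, he]
  have h' := (((h.add h0).const_mul (1 / 2 : ℝ))).sub_const ((chi .negFour b : ℝ) / (4 * (b : ℝ)))
  rw [show (1 / 2 : ℝ) * (0 + Real.pi / 2 * evenSign b) = Real.pi / 4 * evenSign b by ring] at h'
  refine h'.congr' ?_
  filter_upwards [eventually_ge_atTop b] with N hN
  rw [← sum_range_ite_succ hb hN (fun n => (chi .negFour n : ℝ) / (4 * (b : ℝ))), sub_add_cancel]
  simp only [symmSum, hz, zero_mul, zero_add]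
  rw [mul_sum, ← sum_sub_distrib]
  refine sum_congr rfl fun i _ => ?_
  rw [e1, e2]
  push_cast
  have hs : (i : ℝ) + 1 + b ≠ 0 := by positivity
  split_ifs with hib
  · have : (b : ℝ) = i + 1 := by rw [← hib]; push_cast; ring
    rw [this] at hb' ⊢
    simp only [sub_self, inv_zero]
    rw [show -((i : ℝ) + 1) - (i + 1) = -(2 * (i + 1)) by ring]
    field_simp
    ring
  · have hd : (i : ℝ) + 1 - b ≠ 0 := by
      intro h
      apply hib
      have : (i : ℝ) + 1 = b := by linarith
      exact_mod_cast this
    rw [show ((i : ℝ) + 1) ^ 2 - (b : ℝ) ^ 2 = (i + 1 - b) * (i + 1 + b) by ring,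
      show -((i : ℝ) + 1) - b = -((i : ℝ) + 1 + b) by ring]
    field_simp
    ring

/-! ### Bounds uniform in the truncation -/

theorem exists_sum_inv_sq_sub_le :
    ∃ C : ℝ, 0 ≤ C ∧ ∀ N b : ℕ, ∑ i ∈ range N, ((((i + 1 : ℕ) : ℝ) - b) ^ 2)⁻¹ ≤ C := by
  have hs : Summable fun k : ℤ => ((k : ℝ) ^ 2)⁻¹ := by
    simpa using (Real.summable_one_div_int_pow (p := 2)).2 (by norm_num)
  refine ⟨∑' k : ℤ, ((k : ℝ) ^ 2)⁻¹, tsum_nonneg fun k => by positivity, fun N b => ?_⟩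
  let f : ℕ ↪ ℤ := ⟨fun i => (i : ℤ) + 1 - b, fun i j h => by simpa using h⟩
  have := hs.sum_le_tsum ((range N).map f) (fun k _ => by positivity)
  rw [sum_map] at this
  refine le_trans (le_of_eq (sum_congr rfl fun i _ => ?_)) this
  change _ = ((((i : ℤ) + 1 - b : ℤ) : ℝ) ^ 2)⁻¹
  push_cast
  rfl

/-- Off the diagonal `|a² - b²| ≥ (a - b)²`, so a translate of the sum of inverse squares dominates.
-/
theorem exists_abs_sum_chi_div_sq_sub_le (p : CharLabel) :
    ∃ C : ℝ, 0 ≤ C ∧ ∀ N b : ℕ,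
      |∑ i ∈ range N, (chi p (i + 1) : ℝ) * (((i + 1 : ℕ) : ℝ) ^ 2 - (b : ℝ) ^ 2)⁻¹| ≤ C := by
  obtain ⟨C, hC, h⟩ := exists_sum_inv_sq_sub_le
  refine ⟨C, hC, fun N b => (abs_sum_le_sum_abs _ _).trans ((sum_le_sum fun i _ => ?_).trans (h N b))⟩
  rw [abs_mul, abs_inv]
  refine (mul_le_of_le_one_left (by positivity) (abs_chi_le_one p _)).trans ?_
  rcases eq_or_ne ((i + 1 : ℕ) : ℝ) b with hib | hib
  · simp [hib]
  · have hd : 0 < |((i + 1 : ℕ) : ℝ) - b| := abs_pos.2 (sub_ne_zero.2 hib)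
    refine inv_anti₀ (pow_pos hd 2 |>.trans_eq (sq_abs _)) ?_
    rw [sq_sub_sq, abs_mul, ← sq_abs, sq, mul_comm]
    have hle : |((i + 1 : ℕ) : ℝ) - b| ≤ |((i + 1 : ℕ) : ℝ) + b| := by
      rw [abs_of_nonneg (a := ((i + 1 : ℕ) : ℝ) + b) (by positivity), abs_le]
      constructor <;> linarith [Nat.cast_nonneg (α := ℝ) (i + 1), Nat.cast_nonneg (α := ℝ) b]
    rw [mul_comm |_ + _|]
    gcongr

theorem exists_abs_sum_chi_negFour_div_le :
    ∃ C : ℝ, 0 ≤ C ∧ ∀ N : ℕ,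
      |∑ i ∈ range N, (chi .negFour (i + 1) : ℝ) * ((i + 1 : ℕ) : ℝ)⁻¹| ≤ C := by
  obtain ⟨C, hC⟩ := (Metric.isBounded_range_of_tendsto _ tendsto_sum_chi_negFour_div).exists_norm_le
  have := fun N => hC _ (Set.mem_range_self N)
  exact ⟨C, (norm_nonneg _).trans (this 0), this⟩

/-- The difference is `b · (b/(x + b)) · 1/(x(x - b))`, whose middle factor is at most `1`; the last
factor is bounded by the two squares. At `x = b`, with `0⁻¹ = 0`, equality holds. -/
theorem abs_mul_inv_sq_sub_sub_inv_le {x b : ℝ} (hx : 0 < x) (hb : 0 < b) :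
    |x * (x ^ 2 - b ^ 2)⁻¹ - x⁻¹| ≤ b * ((x ^ 2)⁻¹ + ((x - b) ^ 2)⁻¹) := by
  rcases eq_or_ne x b with rfl | hxb
  · simp only [sub_self, inv_zero, mul_zero, zero_sub, abs_neg, abs_inv, abs_of_pos hx]
    refine le_of_eq ?_
    field_simp
    simp
  · have hd : x - b ≠ 0 := sub_ne_zero.2 hxb
    have hs : 0 < x + b := by positivity
    have e : x * (x ^ 2 - b ^ 2)⁻¹ - x⁻¹ = b * ((b / (x + b)) * (x⁻¹ * (x - b)⁻¹)) := by
      rw [sq_sub_sq]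
      field_simp
      ring
    rw [e, abs_mul, abs_of_pos hb, abs_mul, abs_of_pos (div_pos hb hs)]
    gcongr
    refine (mul_le_of_le_one_left (abs_nonneg _) ((div_le_one hs).2 (by linarith))).trans ?_
    rw [← inv_pow, ← inv_pow, abs_le]
    constructor <;> nlinarith [sq_nonneg (x⁻¹ + (x - b)⁻¹), sq_nonneg (x⁻¹ - (x - b)⁻¹),
      sq_nonneg x⁻¹, sq_nonneg (x - b)⁻¹]

/-- The sum is not absolutely bounded, since its terms decay like `1/a`. Subtracting the Leibniz
series, whose partial sums are bounded, leaves an absolutely convergent remainder of size `O(b)`. -/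
theorem exists_abs_sum_chi_negFour_mul_div_sq_sub_le :
    ∃ C : ℝ, 0 ≤ C ∧ ∀ N b : ℕ, 0 < b → |∑ i ∈ range N, (chi .negFour (i + 1) : ℝ) *
        (((i + 1 : ℕ) : ℝ) * (((i + 1 : ℕ) : ℝ) ^ 2 - (b : ℝ) ^ 2)⁻¹)| ≤ C * b := by
  obtain ⟨C₁, hC₁, h₁⟩ := exists_sum_inv_sq_sub_le
  obtain ⟨C₂, hC₂, h₂⟩ := exists_abs_sum_chi_negFour_div_le
  refine ⟨C₂ + 2 * C₁, by positivity, fun N b hb => ?_⟩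
  have hb1 : (1 : ℝ) ≤ b := by exact_mod_cast hb
  have e : ∑ i ∈ range N, (chi .negFour (i + 1) : ℝ) *
        (((i + 1 : ℕ) : ℝ) * (((i + 1 : ℕ) : ℝ) ^ 2 - (b : ℝ) ^ 2)⁻¹)
      = ∑ i ∈ range N, (chi .negFour (i + 1) : ℝ) * ((i + 1 : ℕ) : ℝ)⁻¹
        + ∑ i ∈ range N, (chi .negFour (i + 1) : ℝ) *
          (((i + 1 : ℕ) : ℝ) * (((i + 1 : ℕ) : ℝ) ^ 2 - (b : ℝ) ^ 2)⁻¹ - ((i + 1 : ℕ) : ℝ)⁻¹) := by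
    rw [← sum_add_distrib]
    exact sum_congr rfl fun i _ => by ring
  have h3 : |∑ i ∈ range N, (chi .negFour (i + 1) : ℝ) *
      (((i + 1 : ℕ) : ℝ) * (((i + 1 : ℕ) : ℝ) ^ 2 - (b : ℝ) ^ 2)⁻¹ - ((i + 1 : ℕ) : ℝ)⁻¹)|
      ≤ b * (C₁ + C₁) := by
    have hb0 := h₁ N 0
    simp only [Nat.cast_zero, sub_zero] at hb0
    refine (abs_sum_le_sum_abs _ _).trans (le_trans (sum_le_sum
      (g := fun i => (b : ℝ) * (((((i + 1 : ℕ) : ℝ)) ^ 2)⁻¹ + ((((i + 1 : ℕ) : ℝ) - b) ^ 2)⁻¹))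
      fun i _ => ?_) (le_trans (le_of_eq ?_) (mul_le_mul_of_nonneg_left (add_le_add hb0 (h₁ N b)) (Nat.cast_nonneg b))))
    · rw [abs_mul]
      exact (mul_le_of_le_one_left (abs_nonneg _) (abs_chi_le_one _ _)).trans
        (abs_mul_inv_sq_sub_sub_inv_le (by positivity) (by positivity))
    · rw [← sum_add_distrib, mul_sum]
  rw [e]
  refine (abs_add_le _ _).trans ((add_le_add (h₂ N) h3).trans ?_)
  nlinarith

/-! ### Convergence of the double series -/

/-- The real number `χ_p(n) / n ^ s`. -/
noncomputable def chiTerm (p : CharLabel) (s n : ℕ) : ℝ := (chi p n : ℝ) * ((n : ℝ) ^ s)⁻¹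

/-- The partial sums of `[p,q](s,t)`, as real numbers. -/
noncomputable def charSumPartial (p q : CharLabel) (s t N : ℕ) : ℝ :=
  ∑ n ∈ range N, chiTerm p s (n + 1) * ∑ m ∈ range n, chiTerm q t (m + 1)

theorem abs_chiTerm_le (p : CharLabel) (s n : ℕ) : |chiTerm p s n| ≤ ((n : ℝ) ^ s)⁻¹ := by
  rw [chiTerm, abs_mul, abs_of_nonneg (a := ((n : ℝ) ^ s)⁻¹) (by positivity)]
  exact mul_le_of_le_one_left (by positivity) (abs_chi_le_one p n)

theorem summable_inv_succ_pow {s : ℕ} (hs : 2 ≤ s) :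
    Summable fun n : ℕ => (((n + 1 : ℕ) : ℝ) ^ s)⁻¹ :=
  (summable_nat_add_iff 1).2 (Real.summable_nat_pow_inv.2 (by omega))

theorem summable_chiTerm (p : CharLabel) {s : ℕ} (hs : 2 ≤ s) :
    Summable fun n : ℕ => chiTerm p s (n + 1) :=
  (summable_inv_succ_pow hs).of_norm_bounded fun n => abs_chiTerm_le p s (n + 1)

theorem charSumTerm_succ (p q : CharLabel) (s t n : ℕ) :
    charSumTerm p q s t (n + 1)
      = ((chiTerm p s (n + 1) * ∑ m ∈ range n, chiTerm q t (m + 1) : ℝ) : ℂ) := by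
  rw [charSumTerm, sum_Ico_eq_sum_range, ← mul_sum]
  simp only [chiTerm, div_eq_mul_inv, Nat.add_sub_cancel]
  push_cast
  simp only [add_comm]

theorem hasSum_conditional_iff {f : ℕ → ℂ} {a : ℂ} :
    HasSum f a (SummationFilter.conditional ℕ)
      ↔ Tendsto (fun N => ∑ i ∈ range N, f i) atTop (𝓝 a) := by
  simp [HasSum, tendsto_map'_iff, Function.comp_def]

theorem sum_charSumTerm (p q : CharLabel) (s t N : ℕ) :
    ∑ n ∈ range N, charSumTerm p q s t (n + 1) = (charSumPartial p q s t N : ℂ) := by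
  simp only [charSumTerm_succ, charSumPartial, Complex.ofReal_sum]

theorem charSumConverges_of_tendsto {p q : CharLabel} {s t : ℕ} {a : ℝ}
    (h : Tendsto (charSumPartial p q s t) atTop (𝓝 a)) : CharSumConverges p q s t := by
  refine ⟨(a : ℂ), hasSum_conditional_iff.2 ?_⟩
  simp only [sum_charSumTerm]
  exact (Complex.continuous_ofReal.tendsto a).comp h

theorem CharSumConverges.tendsto {p q : CharLabel} {s t : ℕ} (h : CharSumConverges p q s t) :
    Tendsto (fun N => (charSumPartial p q s t N : ℂ)) atTop (𝓝 (charSum p q s t)) := by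
  have := hasSum_conditional_iff.1 h.hasSum
  simp only [sum_charSumTerm] at this
  exact this

theorem charSumConverges_of_two_le (p q : CharLabel) {s t : ℕ} (hs : 2 ≤ s) (ht : 2 ≤ t) :
    CharSumConverges p q s t := by
  have h : Summable fun n : ℕ => chiTerm p s (n + 1) * ∑ m ∈ range n, chiTerm q t (m + 1) := by
    refine ((summable_inv_succ_pow hs).mul_right
      (∑' m : ℕ, (((m + 1 : ℕ) : ℝ) ^ t)⁻¹)).of_norm_bounded fun n => ?_
    rw [norm_mul]
    refine mul_le_mul (abs_chiTerm_le p s (n + 1)) ?_ (norm_nonneg _) (by positivity)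
    refine (norm_sum_le _ _).trans ((sum_le_sum fun m _ => abs_chiTerm_le q t (m + 1)).trans ?_)
    exact (summable_inv_succ_pow ht).sum_le_tsum _ fun m _ => by positivity
  exact charSumConverges_of_tendsto h.hasSum.tendsto_sum_nat

theorem charSumConverges_of_three_le (p q : CharLabel) {s : ℕ} (hs : 3 ≤ s) (t : ℕ) :
    CharSumConverges p q s t := by
  obtain ⟨r, rfl⟩ : ∃ r, s = r + 1 := ⟨s - 1, by omega⟩
  have h : Summable fun n : ℕ => chiTerm p (r + 1) (n + 1) * ∑ m ∈ range n, chiTerm q t (m + 1) := by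
    refine (summable_inv_succ_pow (s := r) (by omega)).of_norm_bounded fun n => ?_
    rw [norm_mul]
    have h1 : ‖∑ m ∈ range n, chiTerm q t (m + 1)‖ ≤ ((n + 1 : ℕ) : ℝ) := by
      refine (norm_sum_le_of_le (f := fun m => chiTerm q t (m + 1)) (n := fun _ => (1 : ℝ)) _
        fun m _ => ?_).trans (by simp)
      refine (abs_chiTerm_le q t (m + 1)).trans (inv_le_one_of_one_le₀ (one_le_pow₀ ?_))
      exact_mod_cast Nat.le_add_left 1 m
    refine (mul_le_mul (abs_chiTerm_le p (r + 1) (n + 1)) h1 (norm_nonneg _)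
      (by positivity)).trans (le_of_eq ?_)
    have : ((n + 1 : ℕ) : ℝ) ≠ 0 := by positivity
    field_simp
    ring
  exact charSumConverges_of_tendsto h.hasSum.tendsto_sum_nat

theorem sum_mul_sum_eq_sum_mul_sub (u v : ℕ → ℝ) (N : ℕ) :
    ∑ n ∈ range N, u n * ∑ m ∈ range n, v m
      = ∑ m ∈ range N, v m * (∑ i ∈ range N, u i - ∑ i ∈ range (m + 1), u i) := by
  induction N with
  | zero => simp
  | succ N ih =>
    rw [sum_range_succ, ih, sum_range_succ _ N, sub_self, mul_zero, add_zero, mul_sum,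
      ← sum_add_distrib]
    refine sum_congr rfl fun m _ => ?_
    rw [sum_range_succ _ N]
    ring

/-- Exchanging the summations leaves a section of the Leibniz series as inner sum. It is bounded and
convergent, and the weights `m^(-t)` are summable. -/
theorem charSumConverges_negFour_one (q : CharLabel) {t : ℕ} (ht : 2 ≤ t) :
    CharSumConverges .negFour q 1 t := by
  obtain ⟨C, hC, h⟩ := exists_abs_sum_chi_negFour_div_le
  have h' : ∀ N, |∑ i ∈ range N, chiTerm .negFour 1 (i + 1)| ≤ C := by
    simpa only [chiTerm, pow_one] using h
  have hlim : Tendsto (fun N => ∑ i ∈ range N, chiTerm .negFour 1 (i + 1)) atTop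
      (𝓝 (Real.pi / 4)) := by
    simpa only [chiTerm, pow_one] using tendsto_sum_chi_negFour_div
  refine charSumConverges_of_tendsto ((tendsto_sum_range_of_dominated
    (w := fun m => chiTerm q t (m + 1))
    (Φ := fun N m => ∑ i ∈ range N, chiTerm .negFour 1 (i + 1)
      - ∑ i ∈ range (m + 1), chiTerm .negFour 1 (i + 1))
    ((summable_inv_succ_pow ht).mul_right (C + C)) (fun N m => ?_)
    (fun m => hlim.sub_const _)).congr fun N => ?_)
  · rw [abs_mul]
    exact mul_le_mul (abs_chiTerm_le q t (m + 1))
      ((abs_sub _ _).trans (add_le_add (h' _) (h' _))) (abs_nonneg _) (by positivity)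
  · exact (sum_mul_sum_eq_sum_mul_sub _ _ N).symm

/-! ### Symmetrised sums and the geometric kernel -/

theorem sum_mul_sum_add_eq_sum_ite (u v : ℕ → ℝ) (N : ℕ) :
    ∑ n ∈ range N, u n * ∑ m ∈ range n, v m + ∑ n ∈ range N, v n * ∑ m ∈ range n, u m
      = ∑ i ∈ range N, ∑ j ∈ range N, if i = j then 0 else u i * v j := by
  induction N with
  | zero => simp
  | succ N ih =>
    simp only [sum_range_succ, sum_add_distrib, ↓reduceIte, add_zero]
    rw [← ih]
    have h1 : ∑ i ∈ range N, (if i = N then 0 else u i * v N) = v N * ∑ m ∈ range N, u m := by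
      rw [mul_sum]
      refine sum_congr rfl fun i hi => ?_
      rw [if_neg (mem_range.1 hi).ne, mul_comm]
    have h2 : ∑ j ∈ range N, (if N = j then 0 else u N * v j) = u N * ∑ m ∈ range N, v m := by
      rw [mul_sum]
      refine sum_congr rfl fun i hi => ?_
      rw [if_neg (mem_range.1 hi).ne']
    rw [h1, h2]
    ring

/-- Evaluation of a finite sum of symmetrised character sums from a closed form of the
corresponding finite sum of monomials. -/
theorem sum_charSum_eq {p q : CharLabel} {K : Finset ℕ} {s t : ℕ → ℕ}
    (hconv : ∀ k ∈ K, CharSumConverges p q (s k) (t k) ∧ CharSumConverges q p (t k) (s k))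
    {u v f g : ℕ → ℝ} {A B : ℝ}
    (hker : ∀ a b : ℕ, 0 < a → 0 < b → a ≠ b →
      ∑ k ∈ K, ((a : ℝ) ^ s k)⁻¹ * ((b : ℝ) ^ t k)⁻¹
        = u b * (f a * ((a : ℝ) ^ 2 - (b : ℝ) ^ 2)⁻¹)
          + v a * (g b * ((b : ℝ) ^ 2 - (a : ℝ) ^ 2)⁻¹))
    (hA : Tendsto (fun N => ∑ j ∈ range N, (chi q (j + 1) * u (j + 1)) * ∑ i ∈ range N,
      (chi p (i + 1) : ℝ) * (f (i + 1) * (((i + 1 : ℕ) : ℝ) ^ 2 - ((j + 1 : ℕ) : ℝ) ^ 2)⁻¹))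
      atTop (𝓝 A))
    (hB : Tendsto (fun N => ∑ j ∈ range N, (chi p (j + 1) * v (j + 1)) * ∑ i ∈ range N,
      (chi q (i + 1) : ℝ) * (g (i + 1) * (((i + 1 : ℕ) : ℝ) ^ 2 - ((j + 1 : ℕ) : ℝ) ^ 2)⁻¹))
      atTop (𝓝 B)) :
    ∑ k ∈ K, (charSum p q (s k) (t k) + charSum q p (t k) (s k)) = ((A + B : ℝ) : ℂ) := by
  have h1 : Tendsto (fun N => ∑ k ∈ K, ((charSumPartial p q (s k) (t k) N : ℂ)
      + (charSumPartial q p (t k) (s k) N : ℂ))) atTop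
      (𝓝 (∑ k ∈ K, (charSum p q (s k) (t k) + charSum q p (t k) (s k)))) :=
    tendsto_finsetSum _ fun k hk => (hconv k hk).1.tendsto.add (hconv k hk).2.tendsto
  refine tendsto_nhds_unique h1
    (((Complex.continuous_ofReal.tendsto _).comp (hA.add hB)).congr fun N => ?_)
  have hR : ∑ k ∈ K, (charSumPartial p q (s k) (t k) N + charSumPartial q p (t k) (s k) N)
      = ∑ i ∈ range N, ∑ j ∈ range N, (chi p (i + 1) : ℝ) * chi q (j + 1) *
        (u (j + 1) * (f (i + 1) * (((i + 1 : ℕ) : ℝ) ^ 2 - ((j + 1 : ℕ) : ℝ) ^ 2)⁻¹)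
          + v (i + 1) * (g (j + 1) * (((j + 1 : ℕ) : ℝ) ^ 2 - ((i + 1 : ℕ) : ℝ) ^ 2)⁻¹)) := by
    simp only [charSumPartial, sum_mul_sum_add_eq_sum_ite]
    rw [sum_comm]
    refine sum_congr rfl fun i _ => ?_
    rw [sum_comm]
    refine sum_congr rfl fun j _ => ?_
    by_cases hij : i = j
    -- The diagonal is absent on the left and killed by `0⁻¹ = 0` on the right, so the kernel
    -- identity is needed only for `a ≠ b`.
    · simp [hij]
    · rw [← hker (i + 1) (j + 1) (by omega) (by omega) (by omega), mul_sum]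
      refine sum_congr rfl fun k _ => ?_
      rw [if_neg hij, chiTerm, chiTerm]
      ring
  simp only [Function.comp_apply, ← Complex.ofReal_add, ← Complex.ofReal_sum]
  rw [hR]
  congr 1
  simp only [mul_add, sum_add_distrib]
  congr 1
  · rw [sum_comm]
    refine sum_congr rfl fun j _ => ?_
    rw [mul_sum]
    exact sum_congr rfl fun i _ => by ring
  · refine sum_congr rfl fun j _ => ?_
    rw [mul_sum]
    exact sum_congr rfl fun i _ => by ring

theorem tendsto_sum_mul_sum_chi_div_sq_sub {p : CharLabel} (hp : p ≠ .negFour) (q : CharLabel)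
    {r : ℕ} (hr : 2 ≤ r) :
    Tendsto (fun N => ∑ j ∈ range N, (chi q (j + 1) * (((j + 1 : ℕ) : ℝ) ^ r)⁻¹) * ∑ i ∈ range N,
      (chi p (i + 1) : ℝ) * (1 * (((i + 1 : ℕ) : ℝ) ^ 2 - ((j + 1 : ℕ) : ℝ) ^ 2)⁻¹))
      atTop (𝓝 (∑' j : ℕ, (chi q (j + 1) * (((j + 1 : ℕ) : ℝ) ^ r)⁻¹) *
        ((2 * chi p 0 + chi p (j + 1)) / (4 * ((j + 1 : ℕ) : ℝ) ^ 2)))) := by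
  obtain ⟨C, hC, h⟩ := exists_abs_sum_chi_div_sq_sub_le p
  simp only [one_mul]
  refine tendsto_sum_range_of_dominated ((summable_inv_succ_pow hr).mul_right C) (fun N j => ?_)
    fun j => tendsto_sum_chi_div_sq_sub hp (Nat.succ_pos j)
  rw [abs_mul]
  exact mul_le_mul (abs_chiTerm_le q r (j + 1)) (h N (j + 1)) (abs_nonneg _) (by positivity)

theorem tendsto_sum_mul_sum_chi_negFour_mul_div_sq_sub (q : CharLabel) {r : ℕ} (hr : 3 ≤ r) :
    Tendsto (fun N => ∑ j ∈ range N, (chi q (j + 1) * (((j + 1 : ℕ) : ℝ) ^ r)⁻¹) * ∑ i ∈ range N,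
      (chi .negFour (i + 1) : ℝ) *
        (((i + 1 : ℕ) : ℝ) * (((i + 1 : ℕ) : ℝ) ^ 2 - ((j + 1 : ℕ) : ℝ) ^ 2)⁻¹))
      atTop (𝓝 (∑' j : ℕ, (chi q (j + 1) * (((j + 1 : ℕ) : ℝ) ^ r)⁻¹) *
        (Real.pi / 4 * evenSign (j + 1) - chi .negFour (j + 1) / (4 * ((j + 1 : ℕ) : ℝ))))) := by
  obtain ⟨C, hC, h⟩ := exists_abs_sum_chi_negFour_mul_div_sq_sub_le
  -- One power of `j + 1` absorbs the linear growth of the bound on the inner sum; the remaining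
  -- exponent must still be at least `2`.
  obtain ⟨r, rfl⟩ : ∃ m, r = m + 1 := ⟨r - 1, by omega⟩
  refine tendsto_sum_range_of_dominated ((summable_inv_succ_pow (s := r) (by omega)).mul_right C)
    (fun N j => ?_) fun j => tendsto_sum_chi_negFour_mul_div_sq_sub (Nat.succ_pos j)
  rw [abs_mul]
  refine (mul_le_mul (abs_chiTerm_le q (r + 1) (j + 1)) (h N (j + 1) (Nat.succ_pos j))
    (abs_nonneg _) (by positivity)).trans (le_of_eq ?_)
  have : ((j + 1 : ℕ) : ℝ) ≠ 0 := by positivity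
  field_simp
  ring

theorem sum_inv_pow_mul_inv_pow {a b : ℕ} (ha : 0 < a) (hb : 0 < b) (hab : a ≠ b) (m : ℕ) :
    ∑ i ∈ range m, ((a : ℝ) ^ (2 * i))⁻¹ * ((b : ℝ) ^ (2 * (m - 1 - i)))⁻¹
      = (a : ℝ) ^ 2 * (b : ℝ) ^ 2 * (((b : ℝ) ^ (2 * m))⁻¹ - ((a : ℝ) ^ (2 * m))⁻¹)
        * ((a : ℝ) ^ 2 - (b : ℝ) ^ 2)⁻¹ := by
  have h := geom_sum₂_mul ((a : ℝ) ^ 2)⁻¹ ((b : ℝ) ^ 2)⁻¹ m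
  have ha' : (a : ℝ) ≠ 0 := by positivity
  have hb' : (b : ℝ) ≠ 0 := by positivity
  have hd : (a : ℝ) ^ 2 - (b : ℝ) ^ 2 ≠ 0 := by
    rw [sub_ne_zero, ne_eq, sq_eq_sq₀ (by positivity) (by positivity)]
    exact_mod_cast hab
  simp only [inv_pow, ← pow_mul] at h
  have e : ((a : ℝ) ^ 2)⁻¹ - ((b : ℝ) ^ 2)⁻¹
      = -((a : ℝ) ^ 2 - (b : ℝ) ^ 2) / ((a : ℝ) ^ 2 * (b : ℝ) ^ 2) := by
    field_simp
    ring
  rw [e] at h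
  rw [eq_mul_inv_iff_mul_eq₀ hd]
  have h2 : ∀ S x y D P : ℝ, P ≠ 0 → S * (-D / P) = x - y → S * D = P * (y - x) := by
    intro S x y D P hP hS
    have := congrArg (· * P) hS
    field_simp at this
    linarith
  exact h2 _ _ _ _ _ (by positivity) h

theorem sum_Icc_one_eq_sum_range {M : Type*} [AddCommMonoid M] (f : ℕ → M) (m : ℕ) :
    ∑ k ∈ Icc 1 m, f k = ∑ i ∈ range m, f (i + 1) := by
  rw [range_eq_Ico, sum_Ico_add' f 0 m 1]
  rfl

/-! ### The single series and the zeta and beta values -/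

/-- The real number `L_p(s)`, as an unconditional sum. -/
noncomputable def chiSeries (p : CharLabel) (s : ℕ) : ℝ := ∑' j : ℕ, chiTerm p s (j + 1)

theorem summable_charLTerm_negFour {s : ℕ} (hs : 2 ≤ s) :
    Summable fun j : ℕ => charLTerm .negFour s (j + 1) := by
  have := Complex.ofRealCLM.summable (summable_chiTerm .negFour hs)
  refine this.congr fun j => ?_
  simp [chiTerm, charLTerm, div_eq_mul_inv]

theorem dirichletBeta_eq {s : ℕ} (hs : 2 ≤ s) :
    dirichletBeta s = (chiSeries .negFour s : ℂ) := by
  have h := (Complex.hasSum_ofReal.2 (summable_chiTerm .negFour hs).hasSum).tendsto_sum_nat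
  refine (hasSum_conditional_iff.2 (h.congr fun N => sum_congr rfl fun j _ => ?_)).tsum_eq
  simp [chiTerm, charLTerm, div_eq_mul_inv]

theorem riemannZeta_eq {s : ℕ} (hs : 2 ≤ s) : riemannZeta s = (chiSeries .one s : ℂ) := by
  rw [zeta_nat_eq_tsum_of_gt_one (by omega), chiSeries, Complex.ofReal_tsum,
    Summable.tsum_eq_zero_add]
  · simp [chiTerm, chi, show s ≠ 0 by omega]
  · refine (Complex.ofRealCLM.summable
      (Real.summable_one_div_nat_pow.2 (by omega : 1 < s))).congr fun m => ?_
    simp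

theorem chiSeries_twoA {n : ℕ} (hn : 1 ≤ n) :
    chiSeries .twoA (2 * n) = (1 - ((4 : ℝ) ^ n)⁻¹) * chiSeries .one (2 * n) := by
  have hinj : Function.Injective fun k : ℕ => 2 * k + 1 := fun a b h => by simpa using h
  have hinj' : Function.Injective fun k : ℕ => 2 * k := fun a b h => by simpa using h
  have h1 := summable_chiTerm .one (s := 2 * n) (by omega)
  have h2 := summable_chiTerm .twoA (s := 2 * n) (by omega)
  have e1 := tsum_even_add_odd (f := fun j => chiTerm .one (2 * n) (j + 1))
    (h1.comp_injective hinj') (h1.comp_injective hinj)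
  have e2 := tsum_even_add_odd (f := fun j => chiTerm .twoA (2 * n) (j + 1))
    (h2.comp_injective hinj') (h2.comp_injective hinj)
  have f1 : ∀ k : ℕ, chiTerm .twoA (2 * n) (2 * k + 1) = chiTerm .one (2 * n) (2 * k + 1) := by
    intro k
    simp [chiTerm, chi]
  have f2 : ∀ k : ℕ, chiTerm .twoA (2 * n) (2 * k + 1 + 1) = 0 := by
    intro k
    simp [chiTerm, chi, show (2 * k + 1 + 1) % 2 = 0 by omega]
  have f3 : ∀ k : ℕ, chiTerm .one (2 * n) (2 * k + 1 + 1)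
      = ((4 : ℝ) ^ n)⁻¹ * chiTerm .one (2 * n) (k + 1) := by
    intro k
    have : ((2 * k + 1 + 1 : ℕ) : ℝ) = 2 * ((k + 1 : ℕ) : ℝ) := by push_cast; ring
    have hone (m : ℕ) : (chi .one m : ℝ) = 1 := by simp [chi]
    simp only [chiTerm, hone, this, mul_pow, pow_mul (2 : ℝ) 2 n, mul_inv,
      show (2 : ℝ) ^ 2 = 4 by norm_num, one_mul]
  simp only [f1, f2, tsum_zero, add_zero] at e2
  simp only [f3, tsum_mul_left] at e1
  rw [chiSeries, chiSeries]
  linear_combination e1 - e2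

/-- Only even indices `2k` contribute, with sign `(-1)^k = 1 - 2 χ_{2a}(k)`, so the sum is `4⁻ⁿ
(ζ(2n) - 2 L_{2a}(2n))`. -/
theorem hasSum_evenSign {n : ℕ} (hn : 1 ≤ n) :
    HasSum (fun j : ℕ => (evenSign (j + 1) : ℝ) * (((j + 1 : ℕ) : ℝ) ^ (2 * n))⁻¹)
      (((4 : ℝ) ^ n)⁻¹ * (2 * ((4 : ℝ) ^ n)⁻¹ - 1) * chiSeries .one (2 * n)) := by
  have h1 := (summable_chiTerm .one (s := 2 * n) (by omega)).hasSum
  have h2 := (summable_chiTerm .twoA (s := 2 * n) (by omega)).hasSum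
  rw [← chiSeries] at h1 h2
  have h3 := (h1.sub (h2.mul_left 2)).mul_left ((4 : ℝ) ^ n)⁻¹
  have f2 : ∀ k : ℕ, (evenSign (2 * k + 1) : ℝ) * (((2 * k + 1 : ℕ) : ℝ) ^ (2 * n))⁻¹ = 0 := by
    intro k
    simp only [evenSign]
    rw [if_neg (by omega), if_neg (by omega)]
    simp
  have f3 : ∀ k : ℕ, (evenSign (2 * k + 1 + 1) : ℝ) * (((2 * k + 1 + 1 : ℕ) : ℝ) ^ (2 * n))⁻¹
      = ((4 : ℝ) ^ n)⁻¹ * (chiTerm .one (2 * n) (k + 1) - 2 * chiTerm .twoA (2 * n) (k + 1)) := by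
    intro k
    have : ((2 * k + 1 + 1 : ℕ) : ℝ) = 2 * ((k + 1 : ℕ) : ℝ) := by push_cast; ring
    have he : (evenSign (2 * k + 1 + 1) : ℝ) = 1 - 2 * chi .twoA (k + 1) := by
      simp only [evenSign, chi]
      rcases Nat.mod_two_eq_zero_or_one k with hk | hk
      · rw [if_neg (by omega), if_pos (by omega), if_pos (by omega)]
        norm_num
      · rw [if_pos (by omega), if_neg (by omega)]
        norm_num
    rw [he]
    have hone : (chi .one (k + 1) : ℝ) = 1 := by simp [chi]
    simp only [chiTerm, hone, this, mul_pow, pow_mul (2 : ℝ) 2 n, mul_inv,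
      show (2 : ℝ) ^ 2 = 4 by norm_num]
    ring
  have h4 : HasSum (fun k : ℕ => (evenSign (2 * k + 1) : ℝ) *
      (((2 * k + 1 : ℕ) : ℝ) ^ (2 * n))⁻¹) 0 := by simp only [f2]; exact hasSum_zero
  have := HasSum.even_add_odd (f := fun j : ℕ => (evenSign (j + 1) : ℝ) *
    (((j + 1 : ℕ) : ℝ) ^ (2 * n))⁻¹) h4 (h3.congr_fun f3)
  rw [chiSeries_twoA hn] at this
  convert this using 1
  ring

/-! ### Evaluation of the symmetrised families -/

theorem sum_Icc_reflect {M : Type*} [AddCommMonoid M] (f : ℕ → M) {n : ℕ} :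
    ∑ k ∈ Icc 1 (n - 1), f (n - k) = ∑ k ∈ Icc 1 (n - 1), f k := by
  refine sum_nbij' (fun k => n - k) (fun k => n - k) ?_ ?_ ?_ ?_ ?_
  all_goals simp only [mem_Icc]
  all_goals intro k hk
  · omega
  · omega
  · omega
  · omega
  · trivial

/-- The two inner limits contribute the left side of `h` over `4 b^(2n)`. It depends only on the
parity of `b`, hence is a combination of `1` and `χ_{2a}`: `4α` is its value at even `b`, `4(α + β)`
at odd `b`. -/
theorem sum_charSum_even {p q : CharLabel} (hp : p ≠ .negFour) (hq : q ≠ .negFour) {n : ℕ}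
    (hn : 2 ≤ n) {α β : ℝ}
    (h : ∀ b : ℕ, (chi q b : ℝ) * (2 * chi p 0 + chi p b) + chi p b * (2 * chi q 0 + chi q b)
      = 4 * (α + β * chi .twoA b)) :
    ∑ k ∈ Icc 1 (n - 1), (charSum p q (2 * k) (2 * n - 2 * k) + charSum q p (2 * n - 2 * k) (2 * k))
      = (((α + β * (1 - ((4 : ℝ) ^ n)⁻¹)) * chiSeries .one (2 * n) : ℝ) : ℂ) := by
  have hs := sum_charSum_eq (p := p) (q := q) (K := Icc 1 (n - 1)) (s := fun k => 2 * k)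
    (t := fun k => 2 * n - 2 * k) (fun k hk => by
      rw [mem_Icc] at hk
      exact ⟨charSumConverges_of_two_le _ _ (by omega) (by omega),
        charSumConverges_of_two_le _ _ (by omega) (by omega)⟩)
    (u := fun b => ((b : ℝ) ^ (2 * n - 2))⁻¹) (v := fun a => ((a : ℝ) ^ (2 * n - 2))⁻¹)
    (f := fun _ => 1) (g := fun _ => 1) ?_
    (tendsto_sum_mul_sum_chi_div_sq_sub hp q (by omega))
    (tendsto_sum_mul_sum_chi_div_sq_sub hq p (by omega))
  · rw [hs]
    congr 1
    have h1 := (summable_chiTerm .one (s := 2 * n) (by omega)).hasSum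
    have h2 := (summable_chiTerm .twoA (s := 2 * n) (by omega)).hasSum
    rw [← chiSeries] at h1 h2
    have h3 := ((h1.mul_left α).add (h2.mul_left β)).tsum_eq
    rw [chiSeries_twoA (by omega)] at h3
    rw [show (α + β * (1 - ((4 : ℝ) ^ n)⁻¹)) * chiSeries .one (2 * n) = α * chiSeries .one (2 * n)
      + β * ((1 - ((4 : ℝ) ^ n)⁻¹) * chiSeries .one (2 * n)) by ring, ← h3]
    have hsum : ∀ p q : CharLabel, Summable fun j : ℕ =>
        (chi q (j + 1) * (((j + 1 : ℕ) : ℝ) ^ (2 * n - 2))⁻¹) *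
        ((2 * chi p 0 + chi p (j + 1)) / (4 * ((j + 1 : ℕ) : ℝ) ^ 2)) := by
      intro p q
      refine ((summable_inv_succ_pow (s := 2 * n - 2) (by omega)).mul_right 1).of_norm_bounded
        fun j => ?_
      rw [norm_mul]
      refine mul_le_mul (abs_chiTerm_le q _ (j + 1)) ?_ (norm_nonneg _) (by positivity)
      rw [Real.norm_eq_abs, abs_div, abs_of_pos (a := 4 * ((j + 1 : ℕ) : ℝ) ^ 2) (by positivity)]
      refine (div_le_one (by positivity)).2 ?_
      have hj : (1 : ℝ) ≤ ((j + 1 : ℕ) : ℝ) ^ 2 := one_le_pow₀ (by exact_mod_cast Nat.le_add_left 1 j)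
      have ha := abs_le.1 (abs_chi_le_one p 0)
      have hb := abs_le.1 (abs_chi_le_one p (j + 1))
      rw [abs_le]
      constructor <;> linarith
    rw [← (hsum p q).tsum_add (hsum q p)]
    refine tsum_congr fun j => ?_
    have hj := h (j + 1)
    have hx : ((j + 1 : ℕ) : ℝ) ≠ 0 := by positivity
    have hpow : ((j + 1 : ℕ) : ℝ) ^ (2 * n) = ((j + 1 : ℕ) : ℝ) ^ (2 * n - 2) * ((j + 1 : ℕ) : ℝ) ^ 2 := by
      rw [← pow_add]; congr 1; omega
    have hone : (chi .one (j + 1) : ℝ) = 1 := by simp [chi]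
    simp only [chiTerm, hpow, hone]
    field_simp
    linear_combination hj
  · intro a b ha hb hab
    obtain ⟨m, rfl⟩ : ∃ m, n = m + 1 := ⟨n - 1, by omega⟩
    have h4 := sum_inv_pow_mul_inv_pow ha hb hab m
    rw [Nat.add_sub_cancel, sum_Icc_one_eq_sum_range]
    have h5 : ∀ i ∈ range m, ((a : ℝ) ^ (2 * (i + 1)))⁻¹ * ((b : ℝ) ^ (2 * (m + 1) - 2 * (i + 1)))⁻¹
        = (((a : ℝ) ^ 2)⁻¹ * ((b : ℝ) ^ 2)⁻¹) *
          (((a : ℝ) ^ (2 * i))⁻¹ * ((b : ℝ) ^ (2 * (m - 1 - i)))⁻¹) := by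
      intro i hi
      rw [mem_range] at hi
      rw [show 2 * (m + 1) - 2 * (i + 1) = 2 * (m - 1 - i) + 2 by omega,
        show 2 * (i + 1) = 2 * i + 2 by ring, pow_add, pow_add, mul_inv, mul_inv]
      ring
    rw [sum_congr rfl h5, ← mul_sum, h4, show 2 * (m + 1) - 2 = 2 * m by omega,
      ← neg_sub ((a : ℝ) ^ 2), inv_neg]
    have ha' : (a : ℝ) ≠ 0 := by positivity
    have hb' : (b : ℝ) ≠ 0 := by positivity
    generalize ((a : ℝ) ^ 2 - (b : ℝ) ^ 2)⁻¹ = D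
    field_simp
    ring

/-- The beta terms have coefficients `(2χ_p(0) + 1)/4` and `-1/4`, and the `π` term sees only even
`b`, where `χ_p(b) = χ_p(0)`. So `p` enters only through the factor `χ_p(0)`, which is `1`, `0` or
`-1`. -/
theorem sum_charSum_odd {p : CharLabel} (hp : p ≠ .negFour) {n : ℕ} (hn : 2 ≤ n) :
    ∑ k ∈ Icc 1 n, (charSum p .negFour (2 * k) (2 * n + 1 - 2 * k)
        + charSum .negFour p (2 * n + 1 - 2 * k) (2 * k))
      = ((chi p 0 * (chiSeries .negFour (2 * n + 1) / 2 + Real.pi / 4 *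
          (((4 : ℝ) ^ n)⁻¹ * (2 * ((4 : ℝ) ^ n)⁻¹ - 1) * chiSeries .one (2 * n))) : ℝ) : ℂ) := by
  have hs := sum_charSum_eq (p := p) (q := .negFour) (K := Icc 1 n) (s := fun k => 2 * k)
    (t := fun k => 2 * n + 1 - 2 * k) (fun k hk => by
      rw [mem_Icc] at hk
      rcases Nat.lt_or_ge k n with hk' | hk'
      · exact ⟨charSumConverges_of_two_le _ _ (by omega) (by omega),
          charSumConverges_of_two_le _ _ (by omega) (by omega)⟩
      · refine ⟨charSumConverges_of_three_le _ _ (by omega) _, ?_⟩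
        -- At `k = n` the outer exponent is `1`, and convergence rests on the Leibniz series.
        rw [show 2 * n + 1 - 2 * k = 1 by omega]
        exact charSumConverges_negFour_one _ (by omega))
    (u := fun b => ((b : ℝ) ^ (2 * n - 1))⁻¹) (v := fun a => ((a : ℝ) ^ (2 * n))⁻¹)
    (f := fun _ => 1) (g := fun b => (b : ℝ)) ?_
    (tendsto_sum_mul_sum_chi_div_sq_sub hp .negFour (by omega))
    (tendsto_sum_mul_sum_chi_negFour_mul_div_sq_sub p (by omega))
  · rw [hs]
    congr 1
    have hB := (summable_chiTerm .negFour (s := 2 * n + 1) (by omega)).hasSum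
    rw [← chiSeries] at hB
    have hE := hasSum_evenSign (n := n) (by omega)
    have e1 : ∀ j : ℕ, (chi .negFour (j + 1) * (((j + 1 : ℕ) : ℝ) ^ (2 * n - 1))⁻¹) *
        ((2 * chi p 0 + chi p (j + 1)) / (4 * ((j + 1 : ℕ) : ℝ) ^ 2))
        = ((2 * chi p 0 + 1) / 4 : ℝ) * chiTerm .negFour (2 * n + 1) (j + 1) := by
      intro j
      have hc : (chi .negFour (j + 1) : ℝ) * chi p (j + 1) = chi .negFour (j + 1) := by
        rcases Nat.mod_two_eq_zero_or_one (j + 1) with hj | hj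
        · simp [chi, show (j + 1) % 4 ≠ 1 by omega, show (j + 1) % 4 ≠ 3 by omega]
        · have : chi p (j + 1) = 1 := by
            cases p <;> first | exact absurd rfl hp | simp [chi, hj]
          simp [this]
      have hx : ((j + 1 : ℕ) : ℝ) ≠ 0 := by positivity
      have hpow : ((j + 1 : ℕ) : ℝ) ^ (2 * n + 1)
          = ((j + 1 : ℕ) : ℝ) ^ (2 * n - 1) * ((j + 1 : ℕ) : ℝ) ^ 2 := by
        rw [← pow_add]; congr 1; omega
      simp only [chiTerm, hpow]
      field_simp
      linear_combination hc
    have e2 : ∀ j : ℕ, (chi p (j + 1) * (((j + 1 : ℕ) : ℝ) ^ (2 * n))⁻¹) *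
        (Real.pi / 4 * evenSign (j + 1) - chi .negFour (j + 1) / (4 * ((j + 1 : ℕ) : ℝ)))
        = chi p 0 * (Real.pi / 4) * (evenSign (j + 1) * (((j + 1 : ℕ) : ℝ) ^ (2 * n))⁻¹)
          - 1 / 4 * chiTerm .negFour (2 * n + 1) (j + 1) := by
      intro j
      have hx : ((j + 1 : ℕ) : ℝ) ≠ 0 := by positivity
      simp only [chiTerm, pow_succ _ (2 * n)]
      rcases Nat.mod_two_eq_zero_or_one (j + 1) with hj | hj
      · have h1 : chi .negFour (j + 1) = 0 := by
          simp [chi, show (j + 1) % 4 ≠ 1 by omega, show (j + 1) % 4 ≠ 3 by omega]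
        have h2 : chi p (j + 1) = chi p 0 := by
          cases p <;> first | exact absurd rfl hp | simp [chi, hj]
        rw [h1, h2]
        push_cast
        ring
      · have h1 : evenSign (j + 1) = 0 := by
          simp [evenSign, show (j + 1) % 4 ≠ 0 by omega, show (j + 1) % 4 ≠ 2 by omega]
        have h2 : chi p (j + 1) = 1 := by
          cases p <;> first | exact absurd rfl hp | simp [chi, hj]
        rw [h1, h2]
        field_simp
        push_cast
        ring
    simp only [e1, e2]
    rw [(hB.mul_left _).tsum_eq, ((hE.mul_left _).sub (hB.mul_left _)).tsum_eq]
    ring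
  · intro a b ha hb hab
    have h4 := sum_inv_pow_mul_inv_pow ha hb hab n
    rw [sum_Icc_one_eq_sum_range]
    have h5 : ∀ i ∈ range n, ((a : ℝ) ^ (2 * (i + 1)))⁻¹ * ((b : ℝ) ^ (2 * n + 1 - 2 * (i + 1)))⁻¹
        = (((a : ℝ) ^ 2)⁻¹ * (b : ℝ)⁻¹) *
          (((a : ℝ) ^ (2 * i))⁻¹ * ((b : ℝ) ^ (2 * (n - 1 - i)))⁻¹) := by
      intro i hi
      rw [mem_range] at hi
      rw [show 2 * n + 1 - 2 * (i + 1) = 2 * (n - 1 - i) + 1 by omega,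
        show 2 * (i + 1) = 2 * i + 2 by ring, pow_add, pow_succ, mul_inv, mul_inv]
      ring
    have hpow : (b : ℝ) ^ (2 * n) = (b : ℝ) ^ (2 * n - 1) * b := by
      rw [← pow_succ]; congr 1; omega
    rw [sum_congr rfl h5, ← mul_sum, h4, hpow, ← neg_sub ((a : ℝ) ^ 2), inv_neg]
    have ha' : (a : ℝ) ≠ 0 := by positivity
    have hb' : (b : ℝ) ≠ 0 := by positivity
    generalize ((a : ℝ) ^ 2 - (b : ℝ) ^ 2)⁻¹ = D
    field_simp
    ring

theorem charSumConverges_negFour_odd (q : CharLabel) {n k : ℕ} (hn : 2 ≤ n) :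
    CharSumConverges .negFour q (2 * k + 1) (2 * n - 1 - 2 * k) := by
  rcases Nat.eq_zero_or_pos k with rfl | hk
  · exact charSumConverges_negFour_one _ (by omega)
  · exact charSumConverges_of_three_le _ _ (by omega) _

theorem sum_range_charSum_negFour_reflect (n : ℕ) :
    ∑ k ∈ range n, charSum .negFour .negFour (2 * n - 1 - 2 * k) (2 * k + 1)
      = ∑ k ∈ range n, charSum .negFour .negFour (2 * k + 1) (2 * n - 1 - 2 * k) := by
  rw [← sum_range_reflect]
  refine sum_congr rfl fun k hk => ?_
  rw [mem_range] at hk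
  congr 1 <;> omega

/-- The supports of `χ_{-4}` and `evenSign` are disjoint, so the `π` term drops out, and `χ_{-4}² =
χ_{2a}` turns the rest into `ζ(2n)` without its even terms. The factor `2` arises because reflecting
`k` identifies the two halves of the symmetrised sum. -/
theorem sum_charSum_negFour {n : ℕ} (hn : 2 ≤ n) :
    2 * ∑ k ∈ range n, charSum .negFour .negFour (2 * k + 1) (2 * n - 1 - 2 * k)
      = ((-(1 / 2) * ((1 - ((4 : ℝ) ^ n)⁻¹) * chiSeries .one (2 * n)) : ℝ) : ℂ) := by
  have hs := sum_charSum_eq (p := .negFour) (q := .negFour) (K := range n)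
    (s := fun k => 2 * k + 1) (t := fun k => 2 * n - 1 - 2 * k) (fun k hk => by
      rw [mem_range] at hk
      refine ⟨charSumConverges_negFour_odd _ hn, ?_⟩
      have := charSumConverges_negFour_odd .negFour (n := n) (k := n - 1 - k) hn
      rwa [show 2 * (n - 1 - k) + 1 = 2 * n - 1 - 2 * k by omega,
        show 2 * n - 1 - 2 * (n - 1 - k) = 2 * k + 1 by omega] at this)
    (u := fun b => ((b : ℝ) ^ (2 * n - 1))⁻¹) (v := fun a => ((a : ℝ) ^ (2 * n - 1))⁻¹)
    (f := fun a => (a : ℝ)) (g := fun b => (b : ℝ)) ?_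
    (tendsto_sum_mul_sum_chi_negFour_mul_div_sq_sub .negFour (by omega))
    (tendsto_sum_mul_sum_chi_negFour_mul_div_sq_sub .negFour (by omega))
  · rw [sum_add_distrib, sum_range_charSum_negFour_reflect, ← two_mul] at hs
    rw [hs]
    congr 1
    have e : ∀ j : ℕ, (chi .negFour (j + 1) * (((j + 1 : ℕ) : ℝ) ^ (2 * n - 1))⁻¹) *
        (Real.pi / 4 * evenSign (j + 1) - chi .negFour (j + 1) / (4 * ((j + 1 : ℕ) : ℝ)))
        = -(1 / 4) * chiTerm .twoA (2 * n) (j + 1) := by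
      intro j
      have hx : ((j + 1 : ℕ) : ℝ) ≠ 0 := by positivity
      have h1 : (chi .negFour (j + 1) : ℝ) * evenSign (j + 1) = 0 := by
        simp only [chi, evenSign]
        split_ifs <;> first | omega | simp
      have h2 : (chi .negFour (j + 1) : ℝ) * chi .negFour (j + 1) = chi .twoA (j + 1) := by
        simp only [chi]
        split_ifs <;> first | omega | simp
      have hpow : ((j + 1 : ℕ) : ℝ) ^ (2 * n)
          = ((j + 1 : ℕ) : ℝ) ^ (2 * n - 1) * ((j + 1 : ℕ) : ℝ) := by
        rw [← pow_succ]; congr 1; omega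
      simp only [chiTerm, hpow]
      field_simp
      linear_combination (((j + 1 : ℕ) : ℝ) * Real.pi) * h1 - h2
    simp only [e]
    rw [tsum_mul_left, ← chiSeries, chiSeries_twoA (by omega)]
    ring
  · intro a b ha hb hab
    have h4 := sum_inv_pow_mul_inv_pow ha hb hab n
    have h5 : ∀ i ∈ range n, ((a : ℝ) ^ (2 * i + 1))⁻¹ * ((b : ℝ) ^ (2 * n - 1 - 2 * i))⁻¹
        = ((a : ℝ)⁻¹ * (b : ℝ)⁻¹) *
          (((a : ℝ) ^ (2 * i))⁻¹ * ((b : ℝ) ^ (2 * (n - 1 - i)))⁻¹) := by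
      intro i hi
      rw [mem_range] at hi
      rw [show 2 * n - 1 - 2 * i = 2 * (n - 1 - i) + 1 by omega, pow_succ, pow_succ, mul_inv,
        mul_inv]
      ring
    have hpow : ∀ b : ℕ, (b : ℝ) ^ (2 * n) = (b : ℝ) ^ (2 * n - 1) * b := by
      intro b
      rw [← pow_succ]; congr 1; omega
    rw [sum_congr rfl h5, ← mul_sum, h4, hpow, hpow, ← neg_sub ((a : ℝ) ^ 2), inv_neg]
    have ha' : (a : ℝ) ≠ 0 := by positivity
    have hb' : (b : ℝ) ≠ 0 := by positivity
    generalize ((a : ℝ) ^ 2 - (b : ℝ) ^ 2)⁻¹ = D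
    field_simp
    ring

theorem sum_charSum_swap_reflect (p q : CharLabel) (n : ℕ) :
    ∑ k ∈ Icc 1 (n - 1), charSum q p (2 * n - 2 * k) (2 * k)
      = ∑ k ∈ Icc 1 (n - 1), charSum q p (2 * k) (2 * n - 2 * k) := by
  rw [← sum_Icc_reflect]
  refine sum_congr rfl fun k hk => ?_
  rw [mem_Icc] at hk
  congr 1 <;> omega

/-! ### Specialisation to the four families -/

theorem mainTheorem12 (n : ℕ) (hn : 2 ≤ n) :
    -- all series involved converge
    (∀ p q : CharLabel, ∀ k ∈ Finset.Icc 1 (n - 1), CharSumConverges p q (2 * k) (2 * n - 2 * k)) ∧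
    (∀ k ∈ Finset.Icc 0 (n - 1),
      CharSumConverges .negFour .negFour (2 * k + 1) (2 * n - 1 - 2 * k)) ∧
    (∀ p : CharLabel, ∀ k ∈ Finset.Icc 1 n,
      CharSumConverges p .negFour (2 * k) (2 * n + 1 - 2 * k) ∧
      CharSumConverges .negFour p (2 * n + 1 - 2 * k) (2 * k)) ∧
    Summable (fun j : ℕ => charLTerm .negFour (2 * n + 1) (j + 1)) ∧
    -- first family
    (2 * ∑ k ∈ Finset.Icc 1 (n - 1),
        (charSum .one .twoB (2 * k) (2 * n - 2 * k) + charSum .twoB .one (2 * k) (2 * n - 2 * k))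
      = (1 - (4 : ℂ) ^ (1 - (n : ℤ))) * riemannZeta (2 * (n : ℂ))) ∧
    (-4 * ∑ k ∈ Finset.Icc 1 (n - 1), charSum .twoB .twoB (2 * k) (2 * n - 2 * k)
      = (1 - (4 : ℂ) ^ (1 - (n : ℤ))) * riemannZeta (2 * (n : ℂ))) ∧
    -- second family
    (4 * ∑ k ∈ Finset.Icc 1 (n - 1), charSum .twoA .twoA (2 * k) (2 * n - 2 * k)
      = (1 - (4 : ℂ) ^ (-(n : ℤ))) * riemannZeta (2 * (n : ℂ))) ∧
    (-4 * ∑ k ∈ Finset.Icc 0 (n - 1),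
        charSum .negFour .negFour (2 * k + 1) (2 * n - 1 - 2 * k)
      = (1 - (4 : ℂ) ^ (-(n : ℤ))) * riemannZeta (2 * (n : ℂ))) ∧
    (∑ k ∈ Finset.Icc 1 (n - 1),
        (charSum .one .twoA (2 * k) (2 * n - 2 * k) + charSum .twoA .one (2 * k) (2 * n - 2 * k))
      = (1 - (4 : ℂ) ^ (-(n : ℤ))) * riemannZeta (2 * (n : ℂ))) ∧
    -- third family
    (∑ k ∈ Finset.Icc 1 n,
        (charSum .twoA .negFour (2 * k) (2 * n + 1 - 2 * k)
          + charSum .negFour .twoA (2 * n + 1 - 2 * k) (2 * k)) = 0) ∧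
    (∑ k ∈ Finset.Icc 1 (n - 1),
        (charSum .twoA .twoB (2 * k) (2 * n - 2 * k)
          + charSum .twoB .twoA (2 * n - 2 * k) (2 * k)) = 0) ∧
    -- fourth family
    (2 * ∑ k ∈ Finset.Icc 1 n,
        (charSum .one .negFour (2 * k) (2 * n + 1 - 2 * k)
          + charSum .negFour .one (2 * n + 1 - 2 * k) (2 * k))
      = dirichletBeta (2 * n + 1)
        + ((16 : ℂ) ^ (-(n : ℤ)) - (2 : ℂ) ^ (-1 - 2 * (n : ℤ)))
          * (Real.pi : ℂ) * riemannZeta (2 * (n : ℂ))) ∧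
    (-2 * ∑ k ∈ Finset.Icc 1 n,
        (charSum .twoB .negFour (2 * k) (2 * n + 1 - 2 * k)
          + charSum .negFour .twoB (2 * n + 1 - 2 * k) (2 * k))
      = dirichletBeta (2 * n + 1)
        + ((16 : ℂ) ^ (-(n : ℤ)) - (2 : ℂ) ^ (-1 - 2 * (n : ℤ)))
          * (Real.pi : ℂ) * riemannZeta (2 * (n : ℂ))) := by
  have hZ : riemannZeta (2 * (n : ℂ)) = (chiSeries .one (2 * n) : ℂ) := by
    have := riemannZeta_eq (s := 2 * n) (by omega)
    push_cast at this
    exact this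
  have h4 : (4 : ℂ) ^ (-(n : ℤ)) = ((4 : ℂ) ^ n)⁻¹ := by rw [zpow_neg, zpow_natCast]
  have h4' : (4 : ℂ) ^ (1 - (n : ℤ)) = 4 * ((4 : ℂ) ^ n)⁻¹ := by
    rw [sub_eq_add_neg, zpow_add₀ (by norm_num), zpow_one, h4]
  have h16 : (16 : ℂ) ^ (-(n : ℤ)) = ((4 : ℂ) ^ n)⁻¹ ^ 2 := by
    rw [zpow_neg, zpow_natCast, inv_pow, ← pow_mul, mul_comm, pow_mul]
    norm_num
  have h2 : (2 : ℂ) ^ (-1 - 2 * (n : ℤ)) = 1 / 2 * ((4 : ℂ) ^ n)⁻¹ := by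
    rw [sub_eq_add_neg, zpow_add₀ (by norm_num), ← mul_neg, zpow_mul, ← h4]
    norm_num
  have hβ := dirichletBeta_eq (s := 2 * n + 1) (by omega)
  have hE {p q : CharLabel} (hp : p ≠ .negFour) (hq : q ≠ .negFour) (α β : ℝ) :=
    sum_charSum_even hp hq hn (α := α) (β := β)
  rw [hZ, h4, h4', h16, h2, hβ]
  refine ⟨fun p q k hk => ?_, fun k hk => charSumConverges_negFour_odd _ hn, fun p k hk => ?_,
    summable_charLTerm_negFour (by omega), ?_, ?_, ?_, ?_, ?_, ?_, ?_, ?_, ?_⟩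
  · rw [mem_Icc] at hk
    exact charSumConverges_of_two_le _ _ (by omega) (by omega)
  · rw [mem_Icc] at hk
    rcases Nat.lt_or_ge k n with hk' | hk'
    · exact ⟨charSumConverges_of_two_le _ _ (by omega) (by omega),
        charSumConverges_of_two_le _ _ (by omega) (by omega)⟩
    · refine ⟨charSumConverges_of_three_le _ _ (by omega) _, ?_⟩
      rw [show 2 * n + 1 - 2 * k = 1 by omega]
      exact charSumConverges_negFour_one _ (by omega)
  -- The parity expression is `-6` at even `b` and `2` at odd `b`, so `4α = -6` and `4(α + β) = 2`;
  -- the later pairs are found in the same way.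
  · have h := hE (p := .one) (q := .twoB) (by simp) (by simp) (-3 / 2) 2 fun b => by
      simp only [chi]; split_ifs <;> first | contradiction | norm_num
    rw [sum_add_distrib, sum_charSum_swap_reflect, ← sum_add_distrib] at h
    rw [h]
    push_cast
    ring
  · have h := hE (p := .twoB) (q := .twoB) (by simp) (by simp) (3 / 2) (-2) fun b => by
      simp only [chi]; split_ifs <;> first | contradiction | norm_num
    rw [sum_add_distrib, sum_charSum_swap_reflect, ← two_mul] at h
    push_cast at h
    linear_combination -2 * h
  · have h := hE (p := .twoA) (q := .twoA) (by simp) (by simp) 0 (1 / 2) fun b => by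
      simp only [chi]; split_ifs <;> first | contradiction | norm_num
    rw [sum_add_distrib, sum_charSum_swap_reflect, ← two_mul] at h
    push_cast at h
    linear_combination 2 * h
  · have h := sum_charSum_negFour hn
    have hI : Icc 0 (n - 1) = range n := by
      ext k
      simp only [mem_Icc, mem_range]
      omega
    rw [hI]
    push_cast at h
    linear_combination -2 * h
  · have h := hE (p := .one) (q := .twoA) (by simp) (by simp) 0 1 fun b => by
      simp only [chi]; split_ifs <;> first | contradiction | norm_num
    rw [sum_add_distrib, sum_charSum_swap_reflect, ← sum_add_distrib] at h
    rw [h]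
    push_cast
    ring
  · rw [sum_charSum_odd (by simp) hn]
    simp [chi]
  · rw [hE (p := .twoA) (q := .twoB) (by simp) (by simp) 0 0 fun b => by
      simp only [chi]; split_ifs <;> first | contradiction | norm_num]
    simp
  · rw [sum_charSum_odd (by simp) hn]
    simp only [chi]
    push_cast
    ring
  · rw [sum_charSum_odd (by simp) hn]
    simp only [chi]
    push_cast
    ring
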